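/- Fix $n,m,p,N,K\in\mathbb N_0$ with $N\ge 2n+1$. A plant is $x_{k+1}=Ax_k+Bu_k$, $y_k=Cx_k$ with $x_k\in\mathbb R^n$, $u_k\in\mathbb R^m$, $y_k\in\mathbb R^p$, where $A$ is non-singular, $(A,B)$ is controllable and $(A,C)$ is observable. Its MPC problem has horizon $N$, cost $x_N^\top Px_N+\sum_{k=0}^{N-1}(x_k^\top Qx_k+u_k^\top Ru_k)$ with $Q\succeq0$, $P\succeq0$, $R\succ0$ (semi-definite and definite matrices being symmetric), and bounds $u_{\min}\le u_k\le u_{\max}$ $(0\le k\le N-1)$, $y_{\min}\le y_k\le y_{\max}$ $(1\le k\le N)$. With $z=\operatorname{col}(u_0,\dots,u_{N-1})$ it takes the dense form $$\min_z\ \tfrac12 z^\top Hz+x_0^\top Fz+x_0^\top Yx_0\quad\text{s.t.}\quad Gz\le W+Ox_0,$$ where $\mathcal S$ is the block lower triangular $N\times N$ block matrix with blocks $\mathcal S_{ij}=A^{i-j}B$ for $j\le i$ and $0$ for $j>i$; $\mathcal T=\operatorname{col}(A,A^2,\dots,A^N)$; $\mathcal Q=\operatorname{bdiag}(Q,\dots,Q,P)$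 ($N$ blocks); $\mathcal O=\operatorname{col}(CA,\dots,CA^N)$; $\mathcal G=(I_N\otimes C)\mathcal S$; and $$H=2(I_N\otimes R)+2\mathcal S^\top\mathcal Q\mathcal S,\quad F=2\mathcal T^\top\mathcal Q\mathcal S,\quad Y=Q+\mathcal T^\top\mathcal Q\mathcal T,\quad G=\operatorname{col}(I,-I,\mathcal G,-\mathcal G),$$ $$W=\operatorname{col}(\mathbb 1_N\otimes u_{\max},-\mathbb 1_N\otimes u_{\min},\mathbb 1_N\otimes y_{\max},-\mathbb 1_N\otimes y_{\min}),\quad O=\operatorname{col}(0,0,-\mathcal O,\mathcal O).$$ The problem is solved for $K$ initial states, the columns $x_{0|1},\dots,x_{0|K}$ of $X_0\in\mathbb R^{n\times K}$. Cloud knows the dimensions and the structure above and receives $H$, $G$ and, for $i=1,\dots,K$, the vectors $x_{0|i}^\top F$ and $W+Ox_{0|i}$; it receives nothing else. **Theorem.** (1) There is a map that depends on the received data only and assigns to them matrices $A_t,B_t,C_t,R_t,F_t$ such that, for every such problem with $\operatorname{rank}X_0=n$ and $\mathbb 1_K\notin\operatorname{im}X_0^\top$, there is a non-singular $T\in\mathbb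 R^{n\times n}$ with $$A=TA_tT^{-1},\quad B=TB_t,\quad C=C_tT^{-1},\quad F=T^{-\top}F_t,\quad\text{and}\quad R=R_t.$$ (2) Consider such a problem with $\operatorname{rank}X_0=n$ and $\mathbb 1_K\notin\operatorname{im}X_0^\top$, and let $A_t,B_t,C_t,R_t,F_t$ be any matrices related to it by some non-singular $T$ as in (1). Write $\mathcal S_t,\mathcal T_t$ for the matrices $\mathcal S,\mathcal T$ built from $A_t,B_t$. Then there are $Q_t\succeq0$, $P_t\succeq0$ which, with $\mathcal Q_t=\operatorname{bdiag}(Q_t,\dots,Q_t,P_t)$, satisfy $$2(I_N\otimes R_t)+2\mathcal S_t^\top\mathcal Q_t\mathcal S_t=H,\qquad 2\mathcal T_t^\top\mathcal Q_t\mathcal S_t=F_t,$$ and for every such pair $(Q_t,P_t)$ the following are equivalent: (i) Cloud infers $Q$ and $P$ up to the similarity: there is a pair $(\hat Q,\hat P)$ such that, for every problem $(A',B',C',Q',R',P',u'_{\min},u'_{\max},y'_{\min},y'_{\max},X_0')$ of the above form that yields the same received data, and every non-singular $T'$ with $A'=T'A_tT'^{-1}$, $B'=T'B_t$, $C'=C_tT'^{-1}$,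 one has $Q'=T'^{-\top}\hat QT'^{-1}$ and $P'=T'^{-\top}\hat PT'^{-1}$; (ii) the set $$\mathcal J_t=\{X\in\mathbb R^{n\times n}\mid Q_t+X-A_t^\top XA_t\succeq0,\ P_t+X\succeq0,\ XB_t=0\}$$ is a singleton. -/

import Mathlib

open Matrix
open scoped Kronecker

/-- The private parameters of a family of `K` MPC instances sharing the same plant
`x⁺ = A x + B u`, `y = C x`, stage cost `xᵀ Q x + uᵀ R u`, terminal cost `xᵀ P x` and bounds
`umin ≤ u ≤ umax`, `ymin ≤ y ≤ ymax`. The columns of `X0` are the `K` initial states. -/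
structure MPCProblem (n m p K : ℕ) where
  A : Matrix (Fin n) (Fin n) ℝ
  B : Matrix (Fin n) (Fin m) ℝ
  C : Matrix (Fin p) (Fin n) ℝ
  Q : Matrix (Fin n) (Fin n) ℝ
  R : Matrix (Fin m) (Fin m) ℝ
  P : Matrix (Fin n) (Fin n) ℝ
  umin : Fin m → ℝ
  umax : Fin m → ℝ
  ymin : Fin p → ℝ
  ymax : Fin p → ℝ
  X0 : Matrix (Fin n) (Fin K) ℝ

/-- `[B, AB, …, A^(n-1) B]`. -/
def controllabilityMatrix {n m : ℕ} (A : Matrix (Fin n) (Fin n) ℝ) (B : Matrix (Fin n) (Fin m) ℝ) :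
    Matrix (Fin n) (Fin n × Fin m) ℝ :=
  Matrix.of fun a kb => (A ^ (kb.1 : ℕ) * B) a kb.2

/-- `col(C, CA, …, C A^(n-1))`. -/
def observabilityMatrix {n p : ℕ} (A : Matrix (Fin n) (Fin n) ℝ) (C : Matrix (Fin p) (Fin n) ℝ) :
    Matrix (Fin n × Fin p) (Fin n) ℝ :=
  Matrix.of fun kc b => (C * A ^ (kc.1 : ℕ)) kc.2 b

/-- The block matrix `𝒮`: with `N` block rows and columns, the block in (zero-based) position
`(i, j)` is `A^(i-j) B` for `j ≤ i` and `0` otherwise. -/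
def inputToState {n m : ℕ} (N : ℕ) (A : Matrix (Fin n) (Fin n) ℝ) (B : Matrix (Fin n) (Fin m) ℝ) :
    Matrix (Fin N × Fin n) (Fin N × Fin m) ℝ :=
  Matrix.of fun ia jb =>
    if jb.1 ≤ ia.1 then (A ^ ((ia.1 : ℕ) - (jb.1 : ℕ)) * B) ia.2 jb.2 else 0

/-- The block matrix `𝒯 = col(A, A², …, A^N)`. -/
def initialToState {n : ℕ} (N : ℕ) (A : Matrix (Fin n) (Fin n) ℝ) :
    Matrix (Fin N × Fin n) (Fin n) ℝ :=
  Matrix.of fun ia b => (A ^ ((ia.1 : ℕ) + 1)) ia.2 b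

/-- The block matrix `𝒪 = col(CA, CA², …, C A^N)`. -/
def initialToOutput {n p : ℕ} (N : ℕ) (A : Matrix (Fin n) (Fin n) ℝ)
    (C : Matrix (Fin p) (Fin n) ℝ) : Matrix (Fin N × Fin p) (Fin n) ℝ :=
  Matrix.of fun ic b => (C * A ^ ((ic.1 : ℕ) + 1)) ic.2 b

/-- The block matrix `𝒬 = bdiag(Q, …, Q, P)` with `N` diagonal blocks. -/
def stateWeight {n : ℕ} (N : ℕ) (Q P : Matrix (Fin n) (Fin n) ℝ) :
    Matrix (Fin N × Fin n) (Fin N × Fin n) ℝ :=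
  Matrix.of fun ia jb =>
    if ia.1 = jb.1 then (if (ia.1 : ℕ) + 1 = N then P else Q) ia.2 jb.2 else 0

/-- `H = 2 (I_N ⊗ R) + 2 𝒮ᵀ 𝒬 𝒮`. -/
def denseH {n m : ℕ} (N : ℕ) (A : Matrix (Fin n) (Fin n) ℝ) (B : Matrix (Fin n) (Fin m) ℝ)
    (Q P : Matrix (Fin n) (Fin n) ℝ) (R : Matrix (Fin m) (Fin m) ℝ) :
    Matrix (Fin N × Fin m) (Fin N × Fin m) ℝ :=
  (2 : ℝ) • ((1 : Matrix (Fin N) (Fin N) ℝ) ⊗ₖ R) +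
    (2 : ℝ) • ((inputToState N A B)ᵀ * stateWeight N Q P * inputToState N A B)

/-- `F = 2 𝒯ᵀ 𝒬 𝒮`. -/
def denseF {n m : ℕ} (N : ℕ) (A : Matrix (Fin n) (Fin n) ℝ) (B : Matrix (Fin n) (Fin m) ℝ)
    (Q P : Matrix (Fin n) (Fin n) ℝ) : Matrix (Fin n) (Fin N × Fin m) ℝ :=
  (2 : ℝ) • ((initialToState N A)ᵀ * stateWeight N Q P * inputToState N A B)

/-- Row index of the dense constraints `G z ≤ W + O x₀`: upper and lower input bounds,
then upper and lower output bounds. -/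
abbrev ConstraintIndex (m p N : ℕ) : Type :=
  (Fin N × Fin m) ⊕ (Fin N × Fin m) ⊕ (Fin N × Fin p) ⊕ (Fin N × Fin p)

/-- `G = col(I, -I, 𝒢, -𝒢)` with `𝒢 = (I_N ⊗ C) 𝒮`. -/
def denseG {n m p : ℕ} (N : ℕ) (A : Matrix (Fin n) (Fin n) ℝ) (B : Matrix (Fin n) (Fin m) ℝ)
    (C : Matrix (Fin p) (Fin n) ℝ) : Matrix (ConstraintIndex m p N) (Fin N × Fin m) ℝ :=
  let calG := ((1 : Matrix (Fin N) (Fin N) ℝ) ⊗ₖ C) * inputToState N A B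
  fromRows 1 (fromRows (-1) (fromRows calG (-calG)))

/-- `W = col(𝟙 ⊗ umax, -𝟙 ⊗ umin, 𝟙 ⊗ ymax, -𝟙 ⊗ ymin)`. -/
def denseW {m p : ℕ} (N : ℕ) (umin umax : Fin m → ℝ) (ymin ymax : Fin p → ℝ) :
    ConstraintIndex m p N → ℝ :=
  Sum.elim (fun k => umax k.2) <| Sum.elim (fun k => -umin k.2) <|
    Sum.elim (fun k => ymax k.2) (fun k => -ymin k.2)

/-- `O = col(0, 0, -𝒪, 𝒪)`. -/
def denseO {n p : ℕ} (m N : ℕ) (A : Matrix (Fin n) (Fin n) ℝ) (C : Matrix (Fin p) (Fin n) ℝ) :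
    Matrix (ConstraintIndex m p N) (Fin n) ℝ :=
  fromRows 0 (fromRows 0 (fromRows (-initialToOutput N A C) (initialToOutput N A C)))

/-- What Cloud receives: `H`, `G` and, for each instance `i`, the row vector `x₀ᵢᵀ F` and the
right-hand side `W + O x₀ᵢ`. -/
@[ext]
structure CloudData (m p N K : ℕ) where
  H : Matrix (Fin N × Fin m) (Fin N × Fin m) ℝ
  x0F : Fin K → Fin N × Fin m → ℝ
  G : Matrix (ConstraintIndex m p N) (Fin N × Fin m) ℝ
  rhs : Fin K → ConstraintIndex m p N → ℝ

namespace MPCProblem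

variable {n m p K : ℕ}

/-- The standing assumptions on the plant and the cost, which belong to the structure of the
problem that Cloud is aware of. -/
structure Standing (θ : MPCProblem n m p K) : Prop where
  controllable : (controllabilityMatrix θ.A θ.B).rank = n
  observable : (observabilityMatrix θ.A θ.C).rank = n
  isUnit_det_A : IsUnit θ.A.det
  posSemidef_Q : θ.Q.PosSemidef
  posDef_R : θ.R.PosDef
  posSemidef_P : θ.P.PosSemidef

/-- The matrix `F` of the dense problem with horizon `N`. -/
def F (θ : MPCProblem n m p K) (N : ℕ) : Matrix (Fin n) (Fin N × Fin m) ℝ :=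
  denseF N θ.A θ.B θ.Q θ.P

/-- The initial state of instance `i`. -/
def x0 (θ : MPCProblem n m p K) (i : Fin K) : Fin n → ℝ := fun a => θ.X0 a i

/-- The data sent to Cloud when the problem is solved with horizon `N`. -/
def cloudData (θ : MPCProblem n m p K) (N : ℕ) : CloudData m p N K where
  H := denseH N θ.A θ.B θ.Q θ.P θ.R
  x0F := fun i => θ.x0 i ᵥ* θ.F N
  G := denseG N θ.A θ.B θ.C
  rhs := fun i => denseW N θ.umin θ.umax θ.ymin θ.ymax + denseO m N θ.A θ.C *ᵥ θ.x0 i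

end MPCProblem

/-- The matrices `A_t`, `B_t`, `C_t`, `R` and `F_t` that Cloud computes from its data. -/
structure CloudEstimate (n m p N : ℕ) where
  A : Matrix (Fin n) (Fin n) ℝ
  B : Matrix (Fin n) (Fin m) ℝ
  C : Matrix (Fin p) (Fin n) ℝ
  R : Matrix (Fin m) (Fin m) ℝ
  F : Matrix (Fin n) (Fin N × Fin m) ℝ

namespace CloudEstimate

variable {n m p N K : ℕ}

/-- `T` is a similarity that carries the estimated system to the true one:
`A = T A_t T⁻¹`, `B = T B_t`, `C = C_t T⁻¹`. -/
structure IsSimilarity (e : CloudEstimate n m p N) (θ : MPCProblem n m p K)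
    (T : Matrix (Fin n) (Fin n) ℝ) : Prop where
  isUnit_det : IsUnit T.det
  A_eq : θ.A = T * e.A * T⁻¹
  B_eq : θ.B = T * e.B
  C_eq : θ.C = e.C * T⁻¹

/-- The estimate is right: the system matrices (and `F`) up to one common similarity, and `R`
exactly. -/
def Recovers (e : CloudEstimate n m p N) (θ : MPCProblem n m p K) : Prop :=
  (∃ T : Matrix (Fin n) (Fin n) ℝ, e.IsSimilarity θ T ∧ θ.F N = (T⁻¹)ᵀ * e.F) ∧ θ.R = e.R

/-- The pairs `(Q_t, P_t)` of positive semidefinite matrices consistent with `H` and `F_t`. -/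
def consistentCosts (e : CloudEstimate n m p N) (d : CloudData m p N K) :
    Set (Matrix (Fin n) (Fin n) ℝ × Matrix (Fin n) (Fin n) ℝ) :=
  {QP | QP.1.PosSemidef ∧ QP.2.PosSemidef ∧
    denseH N e.A e.B QP.1 QP.2 e.R = d.H ∧ denseF N e.A e.B QP.1 QP.2 = e.F}

/-- The set `𝒥_t` built from `A_t`, `B_t` and a pair `(Q_t, P_t)`. -/
def ambiguitySet (e : CloudEstimate n m p N) (Qt Pt : Matrix (Fin n) (Fin n) ℝ) :
    Set (Matrix (Fin n) (Fin n) ℝ) :=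
  {X | (Qt + X - e.Aᵀ * X * e.A).PosSemidef ∧ (Pt + X).PosSemidef ∧ X * e.B = 0}

/-- Cloud infers `Q` and `P` up to the similarity: one pair `(Q_t, P_t)` satisfies
`Q = T⁻ᵀ Q_t T⁻¹` and `P = T⁻ᵀ P_t T⁻¹` for every problem that obeys the standing assumptions and
could have produced the data, where `T` is the similarity that carries the estimated system to
the system of that problem. -/
def InfersCosts (e : CloudEstimate n m p N) (d : CloudData m p N K) : Prop :=
  ∃ Qt Pt : Matrix (Fin n) (Fin n) ℝ, ∀ θ : MPCProblem n m p K,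
    θ.Standing → θ.cloudData N = d → ∀ T : Matrix (Fin n) (Fin n) ℝ, e.IsSimilarity θ T →
      θ.Q = (T⁻¹)ᵀ * Qt * T⁻¹ ∧ θ.P = (T⁻¹)ᵀ * Pt * T⁻¹

end CloudEstimate

/-!
The proof rests on four observations.

* The block column of `F` belonging to the input at time `j` is `2 (A^(j+1))ᵀ M B`, and the block
  `(i, j)` of `𝒮ᵀ 𝒬 𝒮`, for `i ≤ j`, is `(A^(j-i) B)ᵀ M B`. Here `M` is the cost-to-go of the
  autonomous system over the remaining `N - 1 - j` steps (`denseF_block`,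
  `inputToState_quadratic_block`). As `A` is non-singular, knowing `F` amounts to knowing `M B` for
  every number of remaining steps. For no remaining steps `M = P`, so `F` determines `P B`; the last
  diagonal block `2 R + 2 Bᵀ P B` of `H` then gives `R` (`inputWeight_eq_of_dense_eq`).

* `G` contains the Markov parameters `C Aᵏ B`. They fix the controllable and observable realization
  `(A, B, C)` up to a similarity, by factoring the Hankel matrix and its shift
  (`exists_similarity_of_markov_eq`).

* The right-hand sides `W + O x₀ᵢ` determine, in fixed coordinates, the initial states up to one
  translation `d` common to all instances. Hence two problems with the same data satisfy
  `X₀ᵀ (F - F') = -𝟙 dᵀ F'`, and both sides vanish because `X₀ᵀ` is injective with `𝟙` outside its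
  range (`F_eq_of_cloudData_eq`).

* Two pairs of weights give the same `F` exactly when `X = P' - P` satisfies `X B = 0` and
  `Q' = Q + X - Aᵀ X A` (`denseF_eq_iff`). Indeed, consecutive costs-to-go of the differences differ
  by a congruence of `E = (Q' - Q) - X + Aᵀ X A`, so that equality of `F` means `X B = 0` and
  `E Aᵏ B = 0` for all `k` up to `N - 2`, and controllability gives `E = 0`. For symmetric weights,
  equality of `F` also implies equality of `H`.

For part (1), any admissible problem with the given data therefore serves as an estimate. For part
(2), after a change of coordinates, the weights of the problems with the same data are exactly the
consistent cost pairs, which the ambiguity set parametrizes (`mem_consistentCosts_iff`). So both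
(i) and (ii) say that there is only one such pair.
-/

/-! ### Block rows and columns of the prediction matrices -/

section BlockForms

variable {n m p N : ℕ} {α β : Type*}

/-- The `k`-th block row of a matrix stacked from `N` blocks. -/
def rowBlock {l : Type*} (L : Matrix (Fin N × l) α ℝ) (k : Fin N) : Matrix l α ℝ :=
  L.submatrix (Prod.mk k) id

/-- The `k`-th diagonal block of `stateWeight N Q P`. -/
def stageWeight (N : ℕ) (Q P : Matrix (Fin n) (Fin n) ℝ) (k : ℕ) : Matrix (Fin n) (Fin n) ℝ :=
  if k + 1 = N then P else Q

theorem rowBlock_ext {l : Type*} {L L' : Matrix (Fin N × l) α ℝ}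
    (h : ∀ k, rowBlock L k = rowBlock L' k) : L = L' := by
  ext ⟨k, a⟩ b
  exact congrFun (congrFun (h k) a) b

theorem rowBlock_kronecker_mul {l l' : Type*} [Fintype l] (M : Matrix l' l ℝ)
    (L : Matrix (Fin N × l) α ℝ) (k : Fin N) :
    rowBlock (((1 : Matrix (Fin N) (Fin N) ℝ) ⊗ₖ M) * L) k = M * rowBlock L k := by
  ext a b
  simp [rowBlock, Matrix.mul_apply, Fintype.sum_prod_type, Matrix.one_apply]

theorem rowBlock_stateWeight_mul (Q P : Matrix (Fin n) (Fin n) ℝ)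
    (L : Matrix (Fin N × Fin n) α ℝ) (k : Fin N) :
    rowBlock (stateWeight N Q P * L) k = stageWeight N Q P k * rowBlock L k := by
  ext a b
  simp [rowBlock, stateWeight, stageWeight, Matrix.mul_apply, Fintype.sum_prod_type]

theorem transpose_mul_eq_sum_rowBlock {l : Type*} [Fintype l] (L : Matrix (Fin N × l) α ℝ)
    (L' : Matrix (Fin N × l) β ℝ) : Lᵀ * L' = ∑ k, (rowBlock L k)ᵀ * rowBlock L' k := by
  ext a b
  simp [rowBlock, Matrix.mul_apply, Matrix.sum_apply, Fintype.sum_prod_type]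

theorem transpose_mul_stateWeight_mul (Q P : Matrix (Fin n) (Fin n) ℝ)
    (L : Matrix (Fin N × Fin n) α ℝ) (L' : Matrix (Fin N × Fin n) β ℝ) :
    Lᵀ * stateWeight N Q P * L' =
      ∑ k : Fin N, (rowBlock L k)ᵀ * stageWeight N Q P k * rowBlock L' k := by
  rw [Matrix.mul_assoc, transpose_mul_eq_sum_rowBlock]
  simp only [rowBlock_stateWeight_mul, Matrix.mul_assoc]

theorem rowBlock_initialToState (A : Matrix (Fin n) (Fin n) ℝ) (k : Fin N) :
    rowBlock (initialToState N A) k = A ^ ((k : ℕ) + 1) := rfl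

theorem rowBlock_initialToOutput (A : Matrix (Fin n) (Fin n) ℝ) (C : Matrix (Fin p) (Fin n) ℝ)
    (k : Fin N) : rowBlock (initialToOutput N A C) k = C * A ^ ((k : ℕ) + 1) := rfl

theorem rowBlock_inputToState (A : Matrix (Fin n) (Fin n) ℝ) (B : Matrix (Fin n) (Fin m) ℝ)
    (k j : Fin N) :
    (rowBlock (inputToState N A B) k).submatrix id (Prod.mk j) =
      if j ≤ k then A ^ ((k : ℕ) - (j : ℕ)) * B else 0 := by
  ext a b
  by_cases h : j ≤ k <;> simp [rowBlock, inputToState, h]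

end BlockForms

/-! ### Costs-to-go and the blocks of `F` and `H` -/

section CostToGo

variable {n m N : ℕ}

/-- The weight of the cost-to-go of the autonomous system `x⁺ = A x` over `s` steps,
with stage weight `Q` and terminal weight `P`. -/
def costToGo (A Q P : Matrix (Fin n) (Fin n) ℝ) (s : ℕ) : Matrix (Fin n) (Fin n) ℝ :=
  ∑ l ∈ Finset.range s, (A ^ l)ᵀ * Q * A ^ l + (A ^ s)ᵀ * P * A ^ s

theorem costToGo_zero (A Q P : Matrix (Fin n) (Fin n) ℝ) : costToGo A Q P 0 = P := by
  simp [costToGo]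

theorem costToGo_succ_sub (A Q P : Matrix (Fin n) (Fin n) ℝ) (s : ℕ) :
    costToGo A Q P (s + 1) - costToGo A Q P s = (A ^ s)ᵀ * (Q - P + Aᵀ * P * A) * A ^ s := by
  simp only [costToGo, Finset.sum_range_succ, pow_succ' A, Matrix.transpose_mul]
  noncomm_ring

theorem costToGo_sub (A Q P Q' P' : Matrix (Fin n) (Fin n) ℝ) (s : ℕ) :
    costToGo A (Q' - Q) (P' - P) s = costToGo A Q' P' s - costToGo A Q P s := by
  simp only [costToGo, Matrix.mul_sub, Matrix.sub_mul, Finset.sum_sub_distrib]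
  abel

/-- The states reached after time `j` from an input at time `j` follow the autonomous dynamics,
so their weighted sum is a cost-to-go. -/
theorem sum_stageWeight_eq_costToGo (A Q P : Matrix (Fin n) (Fin n) ℝ) (j : Fin N) :
    ∑ k : Fin N, (if j ≤ k then
      (A ^ ((k : ℕ) - j))ᵀ * stageWeight N Q P k * A ^ ((k : ℕ) - j) else 0) =
      costToGo A Q P (N - 1 - j) := by
  have hj := j.isLt
  simp only [Fin.le_def]
  rw [Fin.sum_univ_eq_sum_range (fun k : ℕ => if (j : ℕ) ≤ k then
      (A ^ (k - (j : ℕ)))ᵀ * stageWeight N Q P k * A ^ (k - (j : ℕ)) else 0) N,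
    ← Finset.sum_filter]
  have hfilter : (Finset.range N).filter (fun k => (j : ℕ) ≤ k) = Finset.Ico (j : ℕ) N := by
    ext k
    simp [and_comm]
  obtain ⟨s, hs⟩ : ∃ s, N = j + s + 1 := ⟨N - 1 - j, by omega⟩
  rw [hfilter, Finset.sum_Ico_eq_sum_range, show N - (j : ℕ) = s + 1 by omega,
    show N - 1 - (j : ℕ) = s by omega, Finset.sum_range_succ, costToGo]
  congr 1
  · refine Finset.sum_congr rfl fun l hl => ?_
    have := Finset.mem_range.1 hl
    rw [stageWeight, if_neg (by omega), Nat.add_sub_cancel_left]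
  · rw [stageWeight, if_pos (by omega), Nat.add_sub_cancel_left]

/-- The block column of `F` belonging to the input at time `j`. -/
theorem denseF_block (A : Matrix (Fin n) (Fin n) ℝ) (B : Matrix (Fin n) (Fin m) ℝ)
    (Q P : Matrix (Fin n) (Fin n) ℝ) (j : Fin N) :
    (denseF N A B Q P).submatrix id (Prod.mk j) =
      (2 : ℝ) • ((A ^ ((j : ℕ) + 1))ᵀ * (costToGo A Q P (N - 1 - j) * B)) := by
  rw [denseF, transpose_mul_stateWeight_mul, ← sum_stageWeight_eq_costToGo, Matrix.sum_mul,
    Matrix.mul_sum]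
  ext a b
  simp only [Matrix.submatrix_apply, Matrix.smul_apply, Matrix.sum_apply]
  congr 1
  refine Finset.sum_congr rfl fun k _ => ?_
  have h := rowBlock_inputToState A B k j
  change (((rowBlock (initialToState N A) k)ᵀ * stageWeight N Q P k) *
    (rowBlock (inputToState N A B) k).submatrix id (Prod.mk j)) a b = _
  rw [h, rowBlock_initialToState]
  split_ifs with hjk
  · rw [show (k : ℕ) + 1 = ((k : ℕ) - j) + (j + 1) by have := Fin.le_def.1 hjk; omega, pow_add,
      Matrix.transpose_mul]
    simp only [Matrix.mul_assoc]
  · simp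

/-- The block of `𝒮ᵀ 𝒬 𝒮` belonging to the inputs at times `i ≤ j`. -/
theorem inputToState_quadratic_block (A : Matrix (Fin n) (Fin n) ℝ) (B : Matrix (Fin n) (Fin m) ℝ)
    (Q P : Matrix (Fin n) (Fin n) ℝ) {i j : Fin N} (hij : i ≤ j) :
    ((inputToState N A B)ᵀ * stateWeight N Q P * inputToState N A B).submatrix
        (Prod.mk i) (Prod.mk j) =
      (A ^ ((j : ℕ) - i) * B)ᵀ * (costToGo A Q P (N - 1 - j) * B) := by
  rw [transpose_mul_stateWeight_mul, ← sum_stageWeight_eq_costToGo, Matrix.sum_mul,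
    Matrix.mul_sum]
  ext a b
  simp only [Matrix.submatrix_apply, Matrix.sum_apply]
  refine Finset.sum_congr rfl fun k _ => ?_
  change (((rowBlock (inputToState N A B) k).submatrix id (Prod.mk i))ᵀ * stageWeight N Q P k *
    (rowBlock (inputToState N A B) k).submatrix id (Prod.mk j)) a b = _
  rw [rowBlock_inputToState, rowBlock_inputToState]
  by_cases hjk : j ≤ k
  · rw [if_pos hjk, if_pos (hij.trans hjk), if_pos hjk,
      show (k : ℕ) - i = ((k : ℕ) - j) + (j - i) by
        have := Fin.le_def.1 hjk; have := Fin.le_def.1 hij; omega, pow_add]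
    simp only [Matrix.mul_assoc, Matrix.transpose_mul]
  · simp [hjk]

end CostToGo

/-! ### Weights that produce the same `F` and `H` -/

section CostAmbiguity

variable {n m N : ℕ}

theorem exists_mul_eq_one_of_rank_eq {κ : Type*} [Fintype κ] [DecidableEq κ]
    {M : Matrix (Fin n) κ ℝ} (h : M.rank = n) : ∃ M' : Matrix κ (Fin n) ℝ, M * M' = 1 := by
  rw [← Matrix.mulVec_surjective_iff_exists_right_inverse]
  have hr : LinearMap.range M.mulVecLin = ⊤ :=
    Submodule.eq_top_of_finrank_eq (by simpa [Matrix.rank] using h)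
  exact LinearMap.range_eq_top.1 hr

theorem exists_mul_eq_one_of_rank_eq' {κ : Type*} [Fintype κ] [DecidableEq κ]
    {M : Matrix κ (Fin n) ℝ} (h : M.rank = n) : ∃ M' : Matrix (Fin n) κ ℝ, M' * M = 1 := by
  obtain ⟨L, hL⟩ := exists_mul_eq_one_of_rank_eq (M := Mᵀ) (by rw [Matrix.rank_transpose, h])
  exact ⟨Lᵀ, by rw [← Matrix.transpose_inj, Matrix.transpose_mul, Matrix.transpose_transpose, hL,
    Matrix.transpose_one]⟩

theorem isUnit_transpose_pow {A : Matrix (Fin n) (Fin n) ℝ} (hA : IsUnit A.det) (k : ℕ) :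
    IsUnit (A ^ k)ᵀ.det := by
  rw [Matrix.det_transpose, Matrix.det_pow]
  exact hA.pow k

theorem eq_of_mul_eq_of_isUnit_det {κ : Type*} {M : Matrix (Fin n) (Fin n) ℝ} (hM : IsUnit M.det)
    {L L' : Matrix (Fin n) κ ℝ} (h : M * L = M * L') : L = L' := by
  rw [← Matrix.nonsing_inv_mul_cancel_left M L hM, h, Matrix.nonsing_inv_mul_cancel_left M L' hM]

/-- For non-singular `A`, the matrix `F` carries the same information as the products of `B` with
the costs-to-go. -/
theorem denseF_eq_iff_costToGo {A : Matrix (Fin n) (Fin n) ℝ} {B : Matrix (Fin n) (Fin m) ℝ}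
    {Q P Q' P' : Matrix (Fin n) (Fin n) ℝ} (hA : IsUnit A.det) :
    denseF N A B Q' P' = denseF N A B Q P ↔
      ∀ s < N, costToGo A Q' P' s * B = costToGo A Q P s * B := by
  constructor
  · intro h s hs
    have hj := congrArg
      (fun M => M.submatrix id (Prod.mk (⟨N - 1 - s, by omega⟩ : Fin N))) h
    simp only [denseF_block] at hj
    have h2 := smul_right_injective _ (two_ne_zero' ℝ) hj
    rw [show N - 1 - (N - 1 - s) = s by omega] at h2
    exact eq_of_mul_eq_of_isUnit_det (isUnit_transpose_pow hA _) h2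
  · intro h
    ext a ⟨j, b⟩
    change (denseF N A B Q' P').submatrix id (Prod.mk j) a b =
      (denseF N A B Q P).submatrix id (Prod.mk j) a b
    rw [denseF_block, denseF_block, h _ (by have := j.isLt; omega)]

theorem stateWeight_transpose {Q P : Matrix (Fin n) (Fin n) ℝ} (hQ : Qᵀ = Q) (hP : Pᵀ = P) :
    (stateWeight N Q P)ᵀ = stateWeight N Q P := by
  ext ⟨k, a⟩ ⟨l, b⟩
  by_cases h : k = l
  · subst h
    by_cases hk : (k : ℕ) + 1 = N
    · simpa [stateWeight, hk] using congrFun (congrFun hP a) b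
    · simpa [stateWeight, hk] using congrFun (congrFun hQ a) b
  · simp [stateWeight, h, Ne.symm h]

/-- Once the costs-to-go agree on the range of `B`, so do the quadratic parts of `H`: the blocks on
and above the diagonal by the block formula, the others by symmetry. -/
theorem denseH_eq_of_costToGo {A : Matrix (Fin n) (Fin n) ℝ} {B : Matrix (Fin n) (Fin m) ℝ}
    {Q P Q' P' : Matrix (Fin n) (Fin n) ℝ} (R : Matrix (Fin m) (Fin m) ℝ)
    (hQ : Qᵀ = Q) (hP : Pᵀ = P) (hQ' : Q'ᵀ = Q') (hP' : P'ᵀ = P')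
    (h : ∀ s < N, costToGo A Q' P' s * B = costToGo A Q P s * B) :
    denseH N A B Q' P' R = denseH N A B Q P R := by
  have hle : ∀ (i j : Fin N), i ≤ j → ∀ a b,
      ((inputToState N A B)ᵀ * stateWeight N Q' P' * inputToState N A B) (i, a) (j, b) =
      ((inputToState N A B)ᵀ * stateWeight N Q P * inputToState N A B) (i, a) (j, b) := by
    intro i j hij a b
    have hj := j.isLt
    have h1 := inputToState_quadratic_block A B Q' P' hij
    rw [h _ (by omega), ← inputToState_quadratic_block A B Q P hij] at h1
    exact congrFun (congrFun h1 a) b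
  have hsymm : ∀ {Q P : Matrix (Fin n) (Fin n) ℝ}, Qᵀ = Q → Pᵀ = P → ∀ x y,
      ((inputToState N A B)ᵀ * stateWeight N Q P * inputToState N A B) x y =
      ((inputToState N A B)ᵀ * stateWeight N Q P * inputToState N A B) y x := by
    intro Q P hQ hP x y
    rw [← Matrix.transpose_apply ((inputToState N A B)ᵀ * stateWeight N Q P * inputToState N A B)]
    simp only [Matrix.transpose_mul, Matrix.transpose_transpose, stateWeight_transpose hQ hP,
      Matrix.mul_assoc]
  rw [denseH, denseH]
  congr 2
  ext ⟨i, a⟩ ⟨j, b⟩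
  rcases le_total i j with hij | hij
  · exact hle i j hij a b
  · rw [hsymm hQ' hP', hsymm hQ hP]
    exact hle j i hij b a

theorem eq_zero_of_mul_pow_mul_eq_zero {A : Matrix (Fin n) (Fin n) ℝ} {B : Matrix (Fin n) (Fin m) ℝ}
    (hAB : (controllabilityMatrix A B).rank = n) {E : Matrix (Fin n) (Fin n) ℝ}
    (h : ∀ k < n, E * (A ^ k * B) = 0) : E = 0 := by
  obtain ⟨M, hM⟩ := exists_mul_eq_one_of_rank_eq hAB
  have h0 : E * controllabilityMatrix A B = 0 := by
    ext a ⟨k, b⟩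
    exact congrFun (congrFun (h k k.isLt) a) b
  rw [← Matrix.mul_one E, ← hM, ← Matrix.mul_assoc, h0, Matrix.zero_mul]

/-- The ambiguity of the cost given `F`: the terminal weight may change by any `X` with `X B = 0`,
and the stage weight then has to change by `X - Aᵀ X A`. -/
theorem denseF_eq_iff {A : Matrix (Fin n) (Fin n) ℝ} {B : Matrix (Fin n) (Fin m) ℝ}
    {Q P Q' P' : Matrix (Fin n) (Fin n) ℝ} (hA : IsUnit A.det)
    (hAB : (controllabilityMatrix A B).rank = n) (hN : n + 1 ≤ N) :
    denseF N A B Q' P' = denseF N A B Q P ↔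
      (P' - P) * B = 0 ∧ Q' = Q + (P' - P) - Aᵀ * (P' - P) * A := by
  have hdiff : (∀ s < N, costToGo A Q' P' s * B = costToGo A Q P s * B) ↔
      ∀ s < N, costToGo A (Q' - Q) (P' - P) s * B = 0 := by
    simp only [costToGo_sub, Matrix.sub_mul, sub_eq_zero]
  rw [denseF_eq_iff_costToGo hA, hdiff]
  constructor
  · intro h
    have hX : (P' - P) * B = 0 := by simpa [costToGo_zero] using h 0 (by omega)
    refine ⟨hX, ?_⟩
    -- Consecutive costs-to-go differ by a congruence of the residual `E` of the Lyapunov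
    -- equation, so `E` vanishes on the range of the controllability matrix.
    have hE : (Q' - Q) - (P' - P) + Aᵀ * (P' - P) * A = 0 := by
      refine eq_zero_of_mul_pow_mul_eq_zero hAB fun k hk => ?_
      refine eq_of_mul_eq_of_isUnit_det (isUnit_transpose_pow hA k) ?_
      have h1 := congrArg (· * B) (costToGo_succ_sub A (Q' - Q) (P' - P) k)
      simp only [Matrix.sub_mul _ _ B, h (k + 1) (by omega), h k (by omega), sub_zero] at h1
      rw [Matrix.mul_zero, h1]
      simp only [Matrix.mul_assoc]
    rw [← sub_eq_zero, ← hE]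
    abel
  · rintro ⟨hX, hQ⟩ s -
    have hE : (Q' - Q) - (P' - P) + Aᵀ * (P' - P) * A = 0 := by
      rw [hQ]
      abel
    have hconst : costToGo A (Q' - Q) (P' - P) s = P' - P := by
      induction s with
      | zero => exact costToGo_zero _ _ _
      | succ s ih =>
        have h1 := costToGo_succ_sub A (Q' - Q) (P' - P) s
        rwa [hE, Matrix.mul_zero, Matrix.zero_mul, ih, sub_eq_zero] at h1
    rw [hconst, hX]

/-- The last diagonal block of `H` is `2 R + 2 Bᵀ P B`, and `F` determines `P B`. -/
theorem inputWeight_eq_of_dense_eq {A : Matrix (Fin n) (Fin n) ℝ} {B : Matrix (Fin n) (Fin m) ℝ}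
    {Q P Q' P' : Matrix (Fin n) (Fin n) ℝ} {R R' : Matrix (Fin m) (Fin m) ℝ} (hA : IsUnit A.det)
    (hN : 0 < N) (hF : denseF N A B Q' P' = denseF N A B Q P)
    (hH : denseH N A B Q' P' R' = denseH N A B Q P R) : R' = R := by
  have hc := (denseF_eq_iff_costToGo hA).1 hF
  let i : Fin N := ⟨N - 1, by omega⟩
  have h1 := inputToState_quadratic_block A B Q' P' (le_refl i)
  rw [hc _ (by omega), ← inputToState_quadratic_block A B Q P (le_refl i)] at h1
  ext a b
  have h2 := congrFun (congrFun hH (i, a)) (i, b)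
  have h3 : ((inputToState N A B)ᵀ * stateWeight N Q' P' * inputToState N A B) (i, a) (i, b) =
      ((inputToState N A B)ᵀ * stateWeight N Q P * inputToState N A B) (i, a) (i, b) :=
    congrFun (congrFun h1 a) b
  simp only [denseH, Matrix.add_apply, Matrix.smul_apply, h3, add_left_inj,
    Matrix.kroneckerMap_apply, Matrix.one_apply_eq, one_mul, smul_eq_mul] at h2
  linarith

end CostAmbiguity

/-! ### Change of state coordinates -/

section Coordinates

variable {n m p N K : ℕ}

theorem conj_pow_eq {T : Matrix (Fin n) (Fin n) ℝ} (hT : IsUnit T.det)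
    (A : Matrix (Fin n) (Fin n) ℝ) (k : ℕ) : (T⁻¹ * A * T) ^ k = T⁻¹ * A ^ k * T := by
  induction k with
  | zero => simp [Matrix.nonsing_inv_mul T hT]
  | succ k ih =>
    rw [pow_succ, ih, pow_succ]
    simp only [Matrix.mul_assoc, Matrix.mul_nonsing_inv_cancel_left T _ hT]

theorem inputToState_conj {T : Matrix (Fin n) (Fin n) ℝ} (hT : IsUnit T.det)
    (A : Matrix (Fin n) (Fin n) ℝ) (B : Matrix (Fin n) (Fin m) ℝ) (k : Fin N) :
    rowBlock (inputToState N (T⁻¹ * A * T) (T⁻¹ * B)) k =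
      T⁻¹ * rowBlock (inputToState N A B) k := by
  ext a ⟨j, b⟩
  change (rowBlock (inputToState N (T⁻¹ * A * T) (T⁻¹ * B)) k).submatrix id (Prod.mk j) a b =
    (T⁻¹ * (rowBlock (inputToState N A B) k).submatrix id (Prod.mk j)) a b
  rw [rowBlock_inputToState, rowBlock_inputToState, conj_pow_eq hT]
  split_ifs
  · simp only [Matrix.mul_assoc, Matrix.mul_nonsing_inv_cancel_left T _ hT]
  · simp

theorem stageWeight_conj (T Q P : Matrix (Fin n) (Fin n) ℝ) (k : ℕ) :
    stageWeight N (Tᵀ * Q * T) (Tᵀ * P * T) k = Tᵀ * stageWeight N Q P k * T := by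
  unfold stageWeight
  split_ifs <;> rfl

theorem denseH_conj {T : Matrix (Fin n) (Fin n) ℝ} (hT : IsUnit T.det)
    (A : Matrix (Fin n) (Fin n) ℝ) (B : Matrix (Fin n) (Fin m) ℝ)
    (Q P : Matrix (Fin n) (Fin n) ℝ) (R : Matrix (Fin m) (Fin m) ℝ) :
    denseH N (T⁻¹ * A * T) (T⁻¹ * B) (Tᵀ * Q * T) (Tᵀ * P * T) R = denseH N A B Q P R := by
  have hT' : IsUnit Tᵀ.det := by rwa [Matrix.det_transpose]
  rw [denseH, denseH, transpose_mul_stateWeight_mul, transpose_mul_stateWeight_mul]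
  simp only [inputToState_conj hT, stageWeight_conj]
  simp only [Matrix.transpose_mul, Matrix.mul_assoc,
    Matrix.mul_nonsing_inv_cancel_left T _ hT, Matrix.transpose_nonsing_inv,
    Matrix.nonsing_inv_mul_cancel_left _ _ hT']

theorem denseF_conj {T : Matrix (Fin n) (Fin n) ℝ} (hT : IsUnit T.det)
    (A : Matrix (Fin n) (Fin n) ℝ) (B : Matrix (Fin n) (Fin m) ℝ)
    (Q P : Matrix (Fin n) (Fin n) ℝ) :
    denseF N (T⁻¹ * A * T) (T⁻¹ * B) (Tᵀ * Q * T) (Tᵀ * P * T) = Tᵀ * denseF N A B Q P := by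
  have hT' : IsUnit Tᵀ.det := by rwa [Matrix.det_transpose]
  rw [denseF, denseF, transpose_mul_stateWeight_mul, transpose_mul_stateWeight_mul,
    Matrix.mul_smul, Matrix.mul_sum]
  simp only [inputToState_conj hT, stageWeight_conj, rowBlock_initialToState, conj_pow_eq hT]
  simp only [Matrix.transpose_mul, Matrix.mul_assoc, Matrix.mul_nonsing_inv_cancel_left T _ hT,
    Matrix.transpose_nonsing_inv, Matrix.nonsing_inv_mul_cancel_left _ _ hT']

theorem denseG_conj {T : Matrix (Fin n) (Fin n) ℝ} (hT : IsUnit T.det)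
    (A : Matrix (Fin n) (Fin n) ℝ) (B : Matrix (Fin n) (Fin m) ℝ) (C : Matrix (Fin p) (Fin n) ℝ) :
    denseG N (T⁻¹ * A * T) (T⁻¹ * B) (C * T) = denseG N A B C := by
  have h : ((1 : Matrix (Fin N) (Fin N) ℝ) ⊗ₖ (C * T)) *
      inputToState N (T⁻¹ * A * T) (T⁻¹ * B) =
      ((1 : Matrix (Fin N) (Fin N) ℝ) ⊗ₖ C) * inputToState N A B := by
    refine rowBlock_ext fun k => ?_
    rw [rowBlock_kronecker_mul, rowBlock_kronecker_mul, inputToState_conj hT]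
    simp only [Matrix.mul_assoc, Matrix.mul_nonsing_inv_cancel_left T _ hT]
  simp only [denseG, h]

theorem denseO_conj {T : Matrix (Fin n) (Fin n) ℝ} (hT : IsUnit T.det)
    (A : Matrix (Fin n) (Fin n) ℝ) (C : Matrix (Fin p) (Fin n) ℝ) :
    denseO m N (T⁻¹ * A * T) (C * T) = denseO m N A C * T := by
  have h : initialToOutput N (T⁻¹ * A * T) (C * T) = initialToOutput N A C * T := by
    refine rowBlock_ext fun k => ?_
    change _ = rowBlock (initialToOutput N A C) k * T
    rw [rowBlock_initialToOutput, rowBlock_initialToOutput, conj_pow_eq hT]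
    simp only [Matrix.mul_assoc, Matrix.mul_nonsing_inv_cancel_left T _ hT]
  simp only [denseO, h, Matrix.fromRows_mul, Matrix.zero_mul, Matrix.neg_mul]

theorem controllabilityMatrix_conj {T : Matrix (Fin n) (Fin n) ℝ} (hT : IsUnit T.det)
    (A : Matrix (Fin n) (Fin n) ℝ) (B : Matrix (Fin n) (Fin m) ℝ) :
    controllabilityMatrix (T⁻¹ * A * T) (T⁻¹ * B) = T⁻¹ * controllabilityMatrix A B := by
  ext a ⟨k, b⟩
  change ((T⁻¹ * A * T) ^ (k : ℕ) * (T⁻¹ * B)) a b = (T⁻¹ * (A ^ (k : ℕ) * B)) a b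
  rw [conj_pow_eq hT]
  simp only [Matrix.mul_assoc, Matrix.mul_nonsing_inv_cancel_left T _ hT]

theorem observabilityMatrix_conj {T : Matrix (Fin n) (Fin n) ℝ} (hT : IsUnit T.det)
    (A : Matrix (Fin n) (Fin n) ℝ) (C : Matrix (Fin p) (Fin n) ℝ) :
    observabilityMatrix (T⁻¹ * A * T) (C * T) = observabilityMatrix A C * T := by
  ext ⟨k, c⟩ b
  change (C * T * (T⁻¹ * A * T) ^ (k : ℕ)) c b = (C * A ^ (k : ℕ) * T) c b
  rw [conj_pow_eq hT]
  simp only [Matrix.mul_assoc, Matrix.mul_nonsing_inv_cancel_left T _ hT]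

namespace MPCProblem

/-- The same problem written in the state coordinates `T⁻¹ x`. -/
noncomputable def changeCoords (θ : MPCProblem n m p K) (T : Matrix (Fin n) (Fin n) ℝ) :
    MPCProblem n m p K where
  A := T⁻¹ * θ.A * T
  B := T⁻¹ * θ.B
  C := θ.C * T
  Q := Tᵀ * θ.Q * T
  R := θ.R
  P := Tᵀ * θ.P * T
  umin := θ.umin
  umax := θ.umax
  ymin := θ.ymin
  ymax := θ.ymax
  X0 := T⁻¹ * θ.X0

theorem x0_changeCoords (θ : MPCProblem n m p K) (T : Matrix (Fin n) (Fin n) ℝ) (i : Fin K) :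
    (θ.changeCoords T).x0 i = T⁻¹ *ᵥ θ.x0 i := by
  ext a
  simp [x0, changeCoords, Matrix.mul_apply, Matrix.mulVec, dotProduct]

theorem F_changeCoords (θ : MPCProblem n m p K) {T : Matrix (Fin n) (Fin n) ℝ}
    (hT : IsUnit T.det) : (θ.changeCoords T).F N = Tᵀ * θ.F N :=
  denseF_conj hT _ _ _ _

theorem cloudData_changeCoords (θ : MPCProblem n m p K) {T : Matrix (Fin n) (Fin n) ℝ}
    (hT : IsUnit T.det) : (θ.changeCoords T).cloudData N = θ.cloudData N := by
  refine CloudData.ext (denseH_conj hT _ _ _ _ _) (funext fun i => ?_) (denseG_conj hT _ _ _)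
    (funext fun i => ?_)
  · change (θ.changeCoords T).x0 i ᵥ* (θ.changeCoords T).F N = θ.x0 i ᵥ* θ.F N
    rw [x0_changeCoords, F_changeCoords θ hT, ← Matrix.vecMul_vecMul, Matrix.vecMul_transpose,
      Matrix.mulVec_mulVec, Matrix.mul_nonsing_inv T hT, Matrix.one_mulVec]
  · change denseW N θ.umin θ.umax θ.ymin θ.ymax +
      denseO m N (T⁻¹ * θ.A * T) (θ.C * T) *ᵥ (θ.changeCoords T).x0 i =
      denseW N θ.umin θ.umax θ.ymin θ.ymax + denseO m N θ.A θ.C *ᵥ θ.x0 i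
    rw [x0_changeCoords, denseO_conj hT, Matrix.mulVec_mulVec, Matrix.mul_assoc,
      Matrix.mul_nonsing_inv T hT, Matrix.mul_one]

theorem Standing.changeCoords {θ : MPCProblem n m p K} (h : θ.Standing)
    {T : Matrix (Fin n) (Fin n) ℝ} (hT : IsUnit T.det) : (θ.changeCoords T).Standing where
  controllable := by
    change (controllabilityMatrix (T⁻¹ * θ.A * T) (T⁻¹ * θ.B)).rank = n
    rw [controllabilityMatrix_conj hT, Matrix.rank_mul_eq_right_of_isUnit_det _ _
      (Matrix.isUnit_nonsing_inv_det T hT), h.controllable]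
  observable := by
    change (observabilityMatrix (T⁻¹ * θ.A * T) (θ.C * T)).rank = n
    rw [observabilityMatrix_conj hT, Matrix.rank_mul_eq_left_of_isUnit_det _ _ hT, h.observable]
  isUnit_det_A := by
    change IsUnit (T⁻¹ * θ.A * T).det
    rw [Matrix.det_mul, Matrix.det_mul]
    exact ((Matrix.isUnit_nonsing_inv_det T hT).mul h.isUnit_det_A).mul hT
  posSemidef_Q := by
    change (Tᵀ * θ.Q * T).PosSemidef
    simpa [Matrix.conjTranspose_eq_transpose_of_trivial] using
      h.posSemidef_Q.conjTranspose_mul_mul_same T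
  posDef_R := h.posDef_R
  posSemidef_P := by
    change (Tᵀ * θ.P * T).PosSemidef
    simpa [Matrix.conjTranspose_eq_transpose_of_trivial] using
      h.posSemidef_P.conjTranspose_mul_mul_same T

end MPCProblem

end Coordinates

/-! ### What the data determine -/

section Identification

variable {n m p N K : ℕ}

/-- State-space realizations that are controllable and observable are similar as soon as they have
the same Markov parameters `C Aᵏ B`, `k < 2 n`. -/
theorem exists_similarity_of_markov_eq {A A' : Matrix (Fin n) (Fin n) ℝ}
    {B B' : Matrix (Fin n) (Fin m) ℝ} {C C' : Matrix (Fin p) (Fin n) ℝ}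
    (hAB : (controllabilityMatrix A B).rank = n) (hAC : (observabilityMatrix A C).rank = n)
    (hAB' : (controllabilityMatrix A' B').rank = n)
    (hAC' : (observabilityMatrix A' C').rank = n)
    (h : ∀ k < 2 * n, C * (A ^ k * B) = C' * (A' ^ k * B')) :
    ∃ T : Matrix (Fin n) (Fin n) ℝ, IsUnit T.det ∧ A' = T * A * T⁻¹ ∧ B' = T * B ∧
      C' = C * T⁻¹ := by
  obtain ⟨M, hM⟩ := exists_mul_eq_one_of_rank_eq hAB
  obtain ⟨L, hL⟩ := exists_mul_eq_one_of_rank_eq' hAC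
  obtain ⟨M', hM'⟩ := exists_mul_eq_one_of_rank_eq hAB'
  obtain ⟨L', hL'⟩ := exists_mul_eq_one_of_rank_eq' hAC'
  set Γ := controllabilityMatrix A B
  set Γ' := controllabilityMatrix A' B'
  set Ω := observabilityMatrix A C
  set Ω' := observabilityMatrix A' C'
  -- The Hankel matrix and its shift factor through both realizations.
  have hankel : Ω * Γ = Ω' * Γ' := by
    ext ⟨i, c⟩ ⟨j, b⟩
    change (C * A ^ (i : ℕ) * (A ^ (j : ℕ) * B)) c b = (C' * A' ^ (i : ℕ) * (A' ^ (j : ℕ) * B')) c b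
    have := h (i + j) (by omega)
    rw [pow_add, pow_add] at this
    simpa only [Matrix.mul_assoc] using congrFun (congrFun this c) b
  have shift : Ω * A * Γ = Ω' * A' * Γ' := by
    ext ⟨i, c⟩ ⟨j, b⟩
    change (C * A ^ (i : ℕ) * A * (A ^ (j : ℕ) * B)) c b =
      (C' * A' ^ (i : ℕ) * A' * (A' ^ (j : ℕ) * B')) c b
    have := h (i + 1 + j) (by omega)
    rw [pow_add, pow_add, pow_add, pow_add, pow_one, pow_one] at this
    simpa only [Matrix.mul_assoc] using congrFun (congrFun this c) b
  have input : Ω * B = Ω' * B' := by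
    ext ⟨i, c⟩ b
    change (C * A ^ (i : ℕ) * B) c b = (C' * A' ^ (i : ℕ) * B') c b
    simpa only [Matrix.mul_assoc] using congrFun (congrFun (h i (by omega)) c) b
  have output : C * Γ = C' * Γ' := by
    ext c ⟨j, b⟩
    exact congrFun (congrFun (h j (by omega)) c) b
  let T := Γ' * M
  have hΩ : Ω = Ω' * T := by
    rw [← Matrix.mul_assoc, ← hankel, Matrix.mul_assoc, hM, Matrix.mul_one]
  have hT : IsUnit T.det :=
    Matrix.isUnit_det_of_left_inverse (B := L * Ω') (by rw [Matrix.mul_assoc, ← hΩ, hL])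
  have cancelΩ' : ∀ {l : ℕ} {X Y : Matrix (Fin n) (Fin l) ℝ}, Ω' * X = Ω' * Y → X = Y := by
    intro l X Y hXY
    rw [← Matrix.one_mul X, ← hL', Matrix.mul_assoc, hXY, ← Matrix.mul_assoc, hL', Matrix.one_mul]
  have hA : T * A = A' * T := by
    apply cancelΩ'
    rw [← Matrix.mul_assoc, ← hΩ, ← Matrix.mul_one (Ω * A), ← hM, ← Matrix.mul_assoc, shift]
    simp only [T, Matrix.mul_assoc]
  refine ⟨T, hT, ?_, ?_, ?_⟩
  · rw [hA, Matrix.mul_nonsing_inv_cancel_right T _ hT]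
  · apply cancelΩ'
    rw [← input, ← Matrix.mul_assoc, ← hΩ]
  · have hC : C = C' * T := by
      rw [← Matrix.mul_assoc, ← output, Matrix.mul_assoc, hM, Matrix.mul_one]
    rw [hC, Matrix.mul_nonsing_inv_cancel_right T _ hT]

theorem markov_eq_of_denseG_eq {A A' : Matrix (Fin n) (Fin n) ℝ}
    {B B' : Matrix (Fin n) (Fin m) ℝ} {C C' : Matrix (Fin p) (Fin n) ℝ}
    (h : denseG N A B C = denseG N A' B' C') {k : ℕ} (hk : k < N) :
    C * (A ^ k * B) = C' * (A' ^ k * B') := by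
  have hS : ((1 : Matrix (Fin N) (Fin N) ℝ) ⊗ₖ C) * inputToState N A B =
      ((1 : Matrix (Fin N) (Fin N) ℝ) ⊗ₖ C') * inputToState N A' B' := by
    ext x y
    exact congrFun (congrFun h (Sum.inr (Sum.inr (Sum.inl x)))) y
  -- The first block column of `𝒢` lists the Markov parameters.
  have hblock : ∀ (A : Matrix (Fin n) (Fin n) ℝ) (B : Matrix (Fin n) (Fin m) ℝ)
      (C : Matrix (Fin p) (Fin n) ℝ),
      (rowBlock (((1 : Matrix (Fin N) (Fin N) ℝ) ⊗ₖ C) * inputToState N A B) ⟨k, hk⟩).submatrix id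
        (Prod.mk (⟨0, by omega⟩ : Fin N)) = C * (A ^ k * B) := by
    intro A B C
    rw [rowBlock_kronecker_mul]
    change C * (rowBlock (inputToState N A B) ⟨k, hk⟩).submatrix id
      (Prod.mk (⟨0, by omega⟩ : Fin N)) = _
    rw [rowBlock_inputToState, if_pos (Fin.le_def.2 (Nat.zero_le k))]
    rfl
  rw [← hblock A B C, hS, hblock]

theorem eq_of_output_eq {A : Matrix (Fin n) (Fin n) ℝ} {C : Matrix (Fin p) (Fin n) ℝ}
    (hAC : (observabilityMatrix A C).rank = n) {v w : Fin n → ℝ}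
    (h : ∀ k < n, (C * A ^ k) *ᵥ v = (C * A ^ k) *ᵥ w) : v = w := by
  obtain ⟨L, hL⟩ := exists_mul_eq_one_of_rank_eq' hAC
  have h0 : observabilityMatrix A C *ᵥ v = observabilityMatrix A C *ᵥ w := by
    ext ⟨k, c⟩
    exact congrFun (h k k.isLt) c
  rw [← Matrix.one_mulVec v, ← hL, ← Matrix.mulVec_mulVec, h0, Matrix.mulVec_mulVec, hL,
    Matrix.one_mulVec]

/-- The right-hand sides `W + O x₀ᵢ` determine the initial states up to one common translation:
the bounds are unknown, but do not depend on the instance. -/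
theorem x0_sub_eq_of_rhs_eq {θ θ' : MPCProblem n m p K} (hA : IsUnit θ.A.det)
    (hAC : (observabilityMatrix θ.A θ.C).rank = n) (hN : n ≤ N) (eA : θ'.A = θ.A)
    (eC : θ'.C = θ.C) (h : (θ'.cloudData N).rhs = (θ.cloudData N).rhs) (i j : Fin K) :
    θ.x0 i - θ'.x0 i = θ.x0 j - θ'.x0 j := by
  have hy : ∀ (l : Fin K) (k : ℕ), k < N → (θ.C * θ.A ^ (k + 1)) *ᵥ (θ.x0 l - θ'.x0 l) =
      θ.ymax - θ'.ymax := by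
    intro l k hk
    ext c
    have h1 : θ'.ymax c + -((θ'.C * θ'.A ^ (k + 1)) *ᵥ θ'.x0 l) c =
        θ.ymax c + -((θ.C * θ.A ^ (k + 1)) *ᵥ θ.x0 l) c := by
      have h2 := congrFun (congrFun h l)
        (Sum.inr (Sum.inr (Sum.inl ((⟨k, hk⟩ : Fin N), c))))
      simp only [MPCProblem.cloudData, denseW, denseO, Pi.add_apply, Matrix.fromRows_mulVec,
        Sum.elim_inr, Sum.elim_inl, Matrix.neg_mulVec, Pi.neg_apply] at h2
      exact h2
    rw [eA, eC] at h1
    rw [Matrix.mulVec_sub, Pi.sub_apply, Pi.sub_apply]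
    linarith
  have hinj : θ.A *ᵥ (θ.x0 i - θ'.x0 i) = θ.A *ᵥ (θ.x0 j - θ'.x0 j) := by
    refine eq_of_output_eq hAC fun k hk => ?_
    simp only [Matrix.mulVec_mulVec, Matrix.mul_assoc, ← pow_succ]
    rw [hy i k (by omega), hy j k (by omega)]
  exact Matrix.mulVec_injective_of_isUnit ((Matrix.isUnit_iff_isUnit_det _).2 hA) hinj

/-- In fixed coordinates the data determine `F`. The initial states are known up to a translation
`d` only, so that `X₀ᵀ (F - F') = -𝟙 dᵀ F'`; as `𝟙` is not in the range of the injective map `X₀ᵀ`,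
both sides vanish. -/
theorem F_eq_of_cloudData_eq {θ θ' : MPCProblem n m p K} (hA : IsUnit θ.A.det)
    (hAC : (observabilityMatrix θ.A θ.C).rank = n) (hN : n ≤ N) (hX : θ.X0.rank = n)
    (h1 : (1 : Fin K → ℝ) ∉ Set.range (fun v : Fin n → ℝ => θ.X0ᵀ *ᵥ v))
    (eA : θ'.A = θ.A) (eC : θ'.C = θ.C) (h : θ'.cloudData N = θ.cloudData N) :
    θ'.F N = θ.F N := by
  obtain ⟨L, hL⟩ := exists_mul_eq_one_of_rank_eq' (M := θ.X0ᵀ) (by rw [Matrix.rank_transpose, hX])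
  rcases isEmpty_or_nonempty (Fin K) with hK | ⟨⟨i₀⟩⟩
  · exact absurd ⟨0, Subsingleton.elim _ _⟩ h1
  have hd := x0_sub_eq_of_rhs_eq hA hAC hN eA eC (congrArg CloudData.rhs h)
  ext a jb
  set v : Fin n → ℝ := fun a => θ.F N a jb - θ'.F N a jb with hv
  set d := θ.x0 i₀ - θ'.x0 i₀ with hd0
  set c : ℝ := -(d ⬝ᵥ fun a => θ'.F N a jb) with hc
  have hvc : θ.X0ᵀ *ᵥ v = c • (1 : Fin K → ℝ) := by
    ext i
    have h2 : θ'.x0 i ⬝ᵥ (fun a => θ'.F N a jb) = θ.x0 i ⬝ᵥ (fun a => θ.F N a jb) :=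
      congrFun (congrFun (congrArg CloudData.x0F h) i) jb
    have h3 : θ.x0 i ⬝ᵥ v = θ.x0 i ⬝ᵥ (fun a => θ.F N a jb) -
        θ.x0 i ⬝ᵥ (fun a => θ'.F N a jb) := dotProduct_sub _ _ _
    have h4 : c = -((θ.x0 i ⬝ᵥ fun a => θ'.F N a jb) - θ'.x0 i ⬝ᵥ fun a => θ'.F N a jb) := by
      rw [hc, hd0, hd i₀ i, sub_dotProduct]
    change θ.x0 i ⬝ᵥ v = c * 1
    rw [h3, h4, h2]
    ring
  have hc0 : c = 0 := by
    by_contra hc0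
    refine h1 ⟨c⁻¹ • v, ?_⟩
    change θ.X0ᵀ *ᵥ (c⁻¹ • v) = 1
    rw [Matrix.mulVec_smul, hvc, smul_smul, inv_mul_cancel₀ hc0, one_smul]
  have hv0 : v = 0 := by
    rw [← Matrix.one_mulVec v, ← hL, ← Matrix.mulVec_mulVec, hvc, hc0, zero_smul,
      Matrix.mulVec_zero]
  exact (sub_eq_zero.1 (congrFun hv0 a)).symm

theorem rank_X0_changeCoords {θ : MPCProblem n m p K} {T : Matrix (Fin n) (Fin n) ℝ}
    (hT : IsUnit T.det) : (θ.changeCoords T).X0.rank = θ.X0.rank :=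
  Matrix.rank_mul_eq_right_of_isUnit_det _ _ (Matrix.isUnit_nonsing_inv_det T hT)

theorem one_notMem_range_changeCoords {θ : MPCProblem n m p K} (T : Matrix (Fin n) (Fin n) ℝ)
    (h : (1 : Fin K → ℝ) ∉ Set.range (fun v : Fin n → ℝ => θ.X0ᵀ *ᵥ v)) :
    (1 : Fin K → ℝ) ∉ Set.range (fun v : Fin n → ℝ => (θ.changeCoords T).X0ᵀ *ᵥ v) := by
  rintro ⟨v, hv⟩
  refine h ⟨(T⁻¹)ᵀ *ᵥ v, ?_⟩
  rw [← hv]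
  simp only [MPCProblem.changeCoords, Matrix.transpose_mul, Matrix.mulVec_mulVec]

theorem CloudEstimate.IsSimilarity.changeCoords_eq {e : CloudEstimate n m p N}
    {θ : MPCProblem n m p K} {T : Matrix (Fin n) (Fin n) ℝ} (h : e.IsSimilarity θ T) :
    (θ.changeCoords T).A = e.A ∧ (θ.changeCoords T).B = e.B ∧ (θ.changeCoords T).C = e.C := by
  have hT := h.isUnit_det
  simp only [MPCProblem.changeCoords]
  rw [h.A_eq, h.B_eq, h.C_eq]
  simp only [Matrix.mul_assoc, Matrix.nonsing_inv_mul_cancel_left T _ hT,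
    Matrix.nonsing_inv_mul T hT, Matrix.mul_one, and_self]

theorem eq_conj_inv {T M M' : Matrix (Fin n) (Fin n) ℝ} (hT : IsUnit T.det)
    (h : Tᵀ * M * T = M') : M = (T⁻¹)ᵀ * M' * T⁻¹ := by
  have hT' : IsUnit Tᵀ.det := by rwa [Matrix.det_transpose]
  rw [← h, Matrix.transpose_nonsing_inv]
  simp only [Matrix.mul_assoc, Matrix.mul_nonsing_inv T hT, Matrix.mul_one,
    Matrix.nonsing_inv_mul_cancel_left _ _ hT']

/-- Any two problems with the same data are similar, so the estimate read off from one of them is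
right for the other. -/
theorem recovers_of_cloudData_eq {θ θ' : MPCProblem n m p K} (hN : 2 * n + 1 ≤ N)
    (hθ : θ.Standing) (hθ' : θ'.Standing) (hX : θ.X0.rank = n)
    (h1 : (1 : Fin K → ℝ) ∉ Set.range (fun v : Fin n → ℝ => θ.X0ᵀ *ᵥ v))
    (h : θ'.cloudData N = θ.cloudData N) :
    CloudEstimate.Recovers (⟨θ.A, θ.B, θ.C, θ.R, θ.F N⟩ : CloudEstimate n m p N) θ' := by
  obtain ⟨T, hT, eA, eB, eC⟩ := exists_similarity_of_markov_eq hθ.controllable hθ.observable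
    hθ'.controllable hθ'.observable fun k hk =>
      (markov_eq_of_denseG_eq (congrArg CloudData.G h) (by omega : k < N)).symm
  set e : CloudEstimate n m p N := ⟨θ.A, θ.B, θ.C, θ.R, θ.F N⟩
  have hs : e.IsSimilarity θ' T := ⟨hT, eA, eB, eC⟩
  obtain ⟨hA, hB, hC⟩ := hs.changeCoords_eq
  have hd : (θ'.changeCoords T).cloudData N = θ.cloudData N := by
    rw [MPCProblem.cloudData_changeCoords θ' hT, h]
  have hF := F_eq_of_cloudData_eq hθ.isUnit_det_A hθ.observable (by omega) hX h1 hA hC hd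
  have hH := congrArg CloudData.H hd
  refine ⟨⟨T, hs, ?_⟩, ?_⟩
  · change θ'.F N = (T⁻¹)ᵀ * θ.F N
    have hT' : IsUnit Tᵀ.det := by rwa [Matrix.det_transpose]
    rw [← hF, MPCProblem.F_changeCoords θ' hT, Matrix.transpose_nonsing_inv,
      Matrix.nonsing_inv_mul_cancel_left _ _ hT']
  · simp only [MPCProblem.F, MPCProblem.cloudData] at hF hH
    rw [hA, hB] at hF hH
    exact inputWeight_eq_of_dense_eq hθ.isUnit_det_A (by omega) hF hH

end Identification

/-! ### Inferring the weights of the states -/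

section Inference

variable {n m p N K : ℕ}

/-- The cost pairs consistent with the data are parametrized by the ambiguity set. -/
theorem mem_consistentCosts_iff {e : CloudEstimate n m p N} {d : CloudData m p N K}
    (hA : IsUnit e.A.det) (hAB : (controllabilityMatrix e.A e.B).rank = n) (hN : n + 1 ≤ N)
    {Q P Q' P' : Matrix (Fin n) (Fin n) ℝ} (h : (Q, P) ∈ e.consistentCosts d) :
    (Q', P') ∈ e.consistentCosts d ↔
      P' - P ∈ e.ambiguitySet Q P ∧ Q' = Q + (P' - P) - e.Aᵀ * (P' - P) * e.A := by
  obtain ⟨hQ, hP, hH, hF⟩ := h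
  have hiff := denseF_eq_iff (Q := Q) (P := P) (Q' := Q') (P' := P') hA hAB hN
  have hsymm : ∀ {M : Matrix (Fin n) (Fin n) ℝ}, M.PosSemidef → Mᵀ = M := fun hM => by
    rw [← Matrix.conjTranspose_eq_transpose_of_trivial]
    exact hM.isHermitian.eq
  constructor
  · rintro ⟨hQ', hP', -, hF'⟩
    obtain ⟨hXB, hE⟩ := hiff.1 (hF'.trans hF.symm)
    exact ⟨⟨hE ▸ hQ', by rwa [add_sub_cancel], hXB⟩, hE⟩
  · rintro ⟨⟨hQ', hP', hXB⟩, hE⟩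
    rw [← hE] at hQ'
    rw [add_sub_cancel] at hP'
    have hF' := hiff.2 ⟨hXB, hE⟩
    refine ⟨hQ', hP', ?_, hF'.trans hF⟩
    rw [← hH]
    exact denseH_eq_of_costToGo e.R (hsymm hQ) (hsymm hP) (hsymm hQ') (hsymm hP')
      ((denseF_eq_iff_costToGo hA).1 hF')

theorem subsingleton_consistentCosts_iff {e : CloudEstimate n m p N} {d : CloudData m p N K}
    (hA : IsUnit e.A.det) (hAB : (controllabilityMatrix e.A e.B).rank = n) (hN : n + 1 ≤ N)
    {Q P : Matrix (Fin n) (Fin n) ℝ} (h : (Q, P) ∈ e.consistentCosts d) :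
    (e.consistentCosts d).Subsingleton ↔ ∃ X, e.ambiguitySet Q P = {X} := by
  constructor
  · intro hs
    refine ⟨0, Set.eq_singleton_iff_unique_mem.2 ⟨?_, fun X hX => ?_⟩⟩
    · exact ⟨by simpa using h.1, by simpa using h.2.1, Matrix.zero_mul _⟩
    · have hmem : (Q + X - e.Aᵀ * X * e.A, P + X) ∈ e.consistentCosts d :=
        (mem_consistentCosts_iff hA hAB hN h).2
          (by simpa only [add_sub_cancel_left, and_true] using hX)
      simpa using congrArg Prod.snd (hs hmem h)
  · rintro ⟨X, hX⟩
    have h0 : (0 : Matrix (Fin n) (Fin n) ℝ) = X := by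
      have : P - P ∈ e.ambiguitySet Q P := ((mem_consistentCosts_iff hA hAB hN h).1 h).1
      rwa [hX, sub_self] at this
    have hall : ∀ QP ∈ e.consistentCosts d, QP = (Q, P) := by
      rintro ⟨Q', P'⟩ h'
      obtain ⟨hmem, hQ'⟩ := (mem_consistentCosts_iff hA hAB hN h).1 h'
      rw [hX, ← h0, Set.mem_singleton_iff] at hmem
      rw [hmem, Matrix.mul_zero, Matrix.zero_mul, add_zero, sub_zero] at hQ'
      rw [hQ', sub_eq_zero.1 hmem]
    exact fun a ha b hb => (hall a ha).trans (hall b hb).symm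

/-- Stated for a problem already written in the coordinates of the estimate: Cloud infers the cost
exactly when only one pair of weights is consistent with the data. -/
theorem infersCosts_iff_subsingleton {e : CloudEstimate n m p N} {θ : MPCProblem n m p K}
    (hN : 2 * n + 1 ≤ N) (hθ : θ.Standing) (hX : θ.X0.rank = n)
    (h1 : (1 : Fin K → ℝ) ∉ Set.range (fun v : Fin n → ℝ => θ.X0ᵀ *ᵥ v))
    (he : e = ⟨θ.A, θ.B, θ.C, θ.R, θ.F N⟩) :
    e.InfersCosts (θ.cloudData N) ↔ (e.consistentCosts (θ.cloudData N)).Subsingleton := by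
  subst he
  set e : CloudEstimate n m p N := ⟨θ.A, θ.B, θ.C, θ.R, θ.F N⟩
  constructor
  · rintro ⟨Qt, Pt, h⟩
    have hall : ∀ QP ∈ e.consistentCosts (θ.cloudData N), QP = (Qt, Pt) := by
      rintro ⟨Q', P'⟩ ⟨hQ', hP', hH, hF⟩
      -- Any consistent pair is the cost of a genuine problem with the same data.
      have hdata : ({ θ with Q := Q', P := P' } : MPCProblem n m p K).cloudData N =
          θ.cloudData N :=
        CloudData.ext hH (funext fun i => congrArg (θ.x0 i ᵥ* ·) hF) rfl rfl
      have hs := h { θ with Q := Q', P := P' }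
        ⟨hθ.controllable, hθ.observable, hθ.isUnit_det_A, hQ', hθ.posDef_R, hP'⟩ hdata 1
        ⟨by simp, by simp [e], by simp [e], by simp [e]⟩
      simp only [inv_one, Matrix.transpose_one, Matrix.one_mul, Matrix.mul_one] at hs
      exact Prod.ext hs.1 hs.2
    exact fun a ha b hb => (hall a ha).trans (hall b hb).symm
  · intro hs
    refine ⟨θ.Q, θ.P, fun θ' hθ' hd T hT => ?_⟩
    have hdet := hT.isUnit_det
    obtain ⟨hA, hB, hC⟩ := hT.changeCoords_eq
    have hd' : (θ'.changeCoords T).cloudData N = θ.cloudData N := by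
      rw [MPCProblem.cloudData_changeCoords θ' hdet, hd]
    have hF := F_eq_of_cloudData_eq hθ.isUnit_det_A hθ.observable (by omega) hX h1 hA hC hd'
    have hH := congrArg CloudData.H hd'
    have hθ'' := hθ'.changeCoords hdet
    have hR : θ'.R = θ.R := by
      simp only [MPCProblem.F, MPCProblem.cloudData] at hF hH
      rw [hA, hB] at hF hH
      exact inputWeight_eq_of_dense_eq hθ.isUnit_det_A (by omega) hF hH
    have hmem : ((θ'.changeCoords T).Q, (θ'.changeCoords T).P) ∈
        e.consistentCosts (θ.cloudData N) := by
      refine ⟨hθ''.posSemidef_Q, hθ''.posSemidef_P, ?_, ?_⟩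
      · rw [← hH, ← hA, ← hB, show e.R = (θ'.changeCoords T).R from hR.symm]
        rfl
      · rw [← hA, ← hB]
        exact hF
    have heq := hs hmem (show (θ.Q, θ.P) ∈ e.consistentCosts (θ.cloudData N) from
      ⟨hθ.posSemidef_Q, hθ.posSemidef_P, rfl, rfl⟩)
    exact ⟨eq_conj_inv hdet (congrArg Prod.fst heq), eq_conj_inv hdet (congrArg Prod.snd heq)⟩

end Inference

theorem mainTheorem5 (n m p N K : ℕ) (hN : 2 * n + 1 ≤ N) :
    (∃ recover : CloudData m p N K → CloudEstimate n m p N,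
      ∀ θ : MPCProblem n m p K, θ.Standing → θ.X0.rank = n →
        (1 : Fin K → ℝ) ∉ Set.range (fun v : Fin n → ℝ => θ.X0ᵀ *ᵥ v) →
        (recover (θ.cloudData N)).Recovers θ) ∧
    (∀ θ : MPCProblem n m p K, θ.Standing → θ.X0.rank = n →
      (1 : Fin K → ℝ) ∉ Set.range (fun v : Fin n → ℝ => θ.X0ᵀ *ᵥ v) →
      ∀ e : CloudEstimate n m p N, e.Recovers θ →
        (e.consistentCosts (θ.cloudData N)).Nonempty ∧
        ∀ Qt Pt : Matrix (Fin n) (Fin n) ℝ, (Qt, Pt) ∈ e.consistentCosts (θ.cloudData N) →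
          (e.InfersCosts (θ.cloudData N) ↔ ∃ X, e.ambiguitySet Qt Pt = {X})) := by
  classical
  constructor
  · -- The estimate is read off from an arbitrary admissible problem with the given data.
    let Admissible (d : CloudData m p N K) (θ : MPCProblem n m p K) : Prop :=
      θ.Standing ∧ θ.X0.rank = n ∧
        (1 : Fin K → ℝ) ∉ Set.range (fun v : Fin n → ℝ => θ.X0ᵀ *ᵥ v) ∧ θ.cloudData N = d
    refine ⟨fun d => if h : ∃ θ, Admissible d θ then
      ⟨h.choose.A, h.choose.B, h.choose.C, h.choose.R, h.choose.F N⟩ else ⟨0, 0, 0, 0, 0⟩, ?_⟩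
    intro θ hθ hX h1
    have h : ∃ θ₀, Admissible (θ.cloudData N) θ₀ := ⟨θ, hθ, hX, h1, rfl⟩
    obtain ⟨hθ₀, hX₀, h1₀, hd⟩ := h.choose_spec
    simp only [dif_pos h]
    exact recovers_of_cloudData_eq hN hθ₀ hθ hX₀ h1₀ hd.symm
  · rintro θ hθ hX h1 e ⟨⟨T, hs, hF⟩, hR⟩
    have hT := hs.isUnit_det
    have hT' : IsUnit Tᵀ.det := by rwa [Matrix.det_transpose]
    obtain ⟨hA, hB, hC⟩ := hs.changeCoords_eq
    have hF' : (θ.changeCoords T).F N = e.F := by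
      rw [MPCProblem.F_changeCoords θ hT, hF, Matrix.transpose_nonsing_inv,
        Matrix.mul_nonsing_inv_cancel_left _ _ hT']
    have he : e = ⟨(θ.changeCoords T).A, (θ.changeCoords T).B, (θ.changeCoords T).C,
        (θ.changeCoords T).R, (θ.changeCoords T).F N⟩ := by
      rw [hA, hB, hC, hF', show (θ.changeCoords T).R = e.R from hR]
    have hstd := hθ.changeCoords hT
    rw [← MPCProblem.cloudData_changeCoords θ hT]
    have hX' := (rank_X0_changeCoords hT).trans hX
    have h1' := one_notMem_range_changeCoords T h1
    generalize θ.changeCoords T = θ₁ at he hstd hX' h1'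
    refine ⟨⟨(θ₁.Q, θ₁.P), ?_⟩, fun Qt Pt hQP => ?_⟩
    · subst he
      exact ⟨hstd.posSemidef_Q, hstd.posSemidef_P, rfl, rfl⟩
    · rw [infersCosts_iff_subsingleton hN hstd hX' h1' he]
      refine subsingleton_consistentCosts_iff ?_ ?_ (by omega) hQP
      · rw [he]
        exact hstd.isUnit_det_A
      · rw [he]
        exact hstd.controllable
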